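/- Let $t\ge 1$ be an integer and let $\overrightarrow{P_3}(t)$ be the $t$-blow-up of the directed path $\overrightarrow{P_3}$ on three vertices, that is, the oriented graph whose vertex set is the union of three disjoint sets $A,B,C$ of size $t$ and whose arcs are all pairs $(a,b)$ with $a\in A$, $b\in B$ and all pairs $(b,c)$ with $b\in B$, $c\in C$. An oriented graph is a finite digraph without loops that contains at most one of the arcs $(u,v)$, $(v,u)$ for any two vertices $u,v$; it is $\overrightarrow{P_3}(t)$-free if it does not contain $\overrightarrow{P_3}(t)$ as a (not necessarily induced) subgraph. **Theorem 3.1.** For every $t\ge 1$ and every $\varepsilon>0$ there exist $\delta>0$ and $N$ such that the following holds for every $n\ge N$. If $G$ is a $\overrightarrow{P_3}(t)$-free oriented graph on $n$ vertices with at least $n^2/4-\delta n^2$ arcs, then the vertex set of $G$ can be partitioned into sets $U$ and $W$ with $|U|=\lfloor n/2\rfloor$ and $|W|=\lceil n/2\rceil$ such that $G$ can be turned into the antidirected complete bipartite graph $K_{\lfloor n/2\rfloor,\lceil n/2\rceil}$ on $U\cup W$, whose arcs are exactly the pairs $(u,w)$ with $u\in U$, $w\in W$, by deleting and adding at most $\varepsilon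 n^2$ arcs in total (reorienting an arc being counted as one deletion and one addition). -/

import Mathlib

namespace Digraph

/-- An oriented graph: no loops, and at most one of the arcs `uv`, `vu` for each pair
(taking `u = v` in the condition shows that there are no loops). -/
def IsOriented {V : Type*} (G : Digraph V) : Prop :=
  ∀ u v, G.Adj u v → ¬ G.Adj v u

/-- `G` contains `F` as a (not necessarily induced) subgraph. -/
def ContainsCopy {V W : Type*} (G : Digraph V) (F : Digraph W) : Prop :=
  ∃ f : W → V, Function.Injective f ∧ ∀ a b, F.Adj a b → G.Adj (f a) (f b)

/-- `G` is `F`-free. -/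
def IsFreeOf {V W : Type*} (G : Digraph V) (F : Digraph W) : Prop :=
  ¬ G.ContainsCopy F

/-- The directed path on `k` vertices, with the arcs `0 → 1 → ⋯ → k - 1`. -/
def dirPath (k : ℕ) : Digraph (Fin k) where
  Adj i j := (i : ℕ) + 1 = (j : ℕ)

/-- The blow-up `F(t)`: each vertex of `F` is replaced by `t` independent vertices, and each arc
of `F` by all `t²` arcs between the two classes, in the same direction. -/
def blowUp {W : Type*} (F : Digraph W) (t : ℕ) : Digraph (W × Fin t) where
  Adj p q := F.Adj p.1 q.1

/-- The complete bipartite graph with parts `U` and the complement of `U`, with its antidirected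
orientation in which every vertex of `U` is a source and every other vertex is a sink. -/
def antidirectedBipartite {V : Type*} (U : Finset V) : Digraph V where
  Adj u v := u ∈ U ∧ v ∉ U

/-- The set of arcs. -/
def arcs {V : Type*} (G : Digraph V) : Set (V × V) :=
  {p | G.Adj p.1 p.2}

/-- The number of single-arc deletions and additions that turn `G` into `H`: the arcs of `G` that
are not in `H` plus the arcs of `H` that are not in `G`. Reorienting an arc is
counted as a deletion and an addition, so this is at least the number of deletions, additions and
reorientations that are needed, and at most twice that number. -/
noncomputable def editCost {V : Type*} (G H : Digraph V) : ℕ :=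
  (G.arcs \ H.arcs).ncard + (H.arcs \ G.arcs).ncard

end Digraph

namespace Digraph

open Finset

section Stability

open scoped Classical

/-! If many vertices had both in- and out-degree linear in n, double counting would give t-sets A
and C with t common middle vertices, hence a blown-up path. So all but boundedly many vertices have
in- or out-degree o(n), and the sum of min(d⁻, d⁺) is at most η n² (`exists_sum_min_card_nbrs_le`).
Let U₀ be the vertices with d⁻ ≤ d⁺. Every arc not going from U₀ to its complement is charged to
such a minimum (`ncard_arcs_diff_le`). Hence nearly n²/4 arcs go from U₀ to its complement; since
|U₀|(n - |U₀|) = n²/4 - (|U₀| - n/2)², U₀ is nearly half of the vertices and few arcs between the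
parts are missing. Moving a few vertices balances the parts exactly. -/

/-- Complete pairs `A → B → C` in an oriented graph give a copy of the blown-up path; the three
classes are automatically disjoint. -/
theorem IsOriented.containsCopy_blowUp_dirPath {V : Type*} {G : Digraph V} (hG : G.IsOriented)
    {t : ℕ} (ht : 1 ≤ t) {A B C : Finset V} (hA : A.card = t) (hB : t ≤ B.card) (hC : C.card = t)
    (hAB : ∀ a ∈ A, ∀ b ∈ B, G.Adj a b) (hBC : ∀ b ∈ B, ∀ c ∈ C, G.Adj b c) :
    G.ContainsCopy ((dirPath 3).blowUp t) := by
  obtain ⟨B', hB', hBt⟩ := exists_subset_card_eq hB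
  let P : Fin 3 → Finset V := ![A, B', C]
  have hP : ∀ i, (P i).card = t := by
    intro i; fin_cases i <;> simp [P, hA, hBt, hC]
  have harc : ∀ i j : Fin 3, (i : ℕ) + 1 = j → ∀ a ∈ P i, ∀ b ∈ P j, G.Adj a b := by
    intro i j hij a ha b hb
    fin_cases i <;> fin_cases j <;> simp [P] at hij ha hb
    · exact hAB a ha b (hB' hb)
    · exact hBC a (hB' ha) b hb
  have hirr : ∀ v, ¬ G.Adj v v := fun v h => hG v v h h
  -- A common vertex `v` of `A` and `C` would give both `v → b₀` and `b₀ → v`.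
  obtain ⟨b₀, hb₀⟩ : B.Nonempty := card_pos.mp (by omega)
  have hdisj : ∀ i j : Fin 3, ∀ v, v ∈ P i → v ∈ P j → i = j := by
    intro i j v hi hj
    by_contra hne
    fin_cases i <;> fin_cases j <;> simp [P] at hi hj hne
    · exact hirr v (hAB v hi v (hB' hj))
    · exact hG _ _ (hAB v hi b₀ hb₀) (hBC b₀ hb₀ v hj)
    · exact hirr v (hAB v hj v (hB' hi))
    · exact hirr v (hBC v (hB' hi) v hj)
    · exact hG _ _ (hAB v hj b₀ hb₀) (hBC b₀ hb₀ v hi)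
    · exact hirr v (hBC v (hB' hj) v hi)
  let e : ∀ i, P i ≃ Fin t := fun i => (P i).equivFinOfCardEq (hP i)
  refine ⟨fun p => ((e p.1).symm p.2 : V), ?_, ?_⟩
  · rintro ⟨i, x⟩ ⟨j, y⟩ h
    have h' : ((e i).symm x : V) = (e j).symm y := h
    obtain rfl : i = j := hdisj i j _ ((e i).symm x).2 (h' ▸ ((e j).symm y).2)
    rw [(e i).symm.injective (Subtype.ext h')]
  · rintro ⟨i, x⟩ ⟨j, y⟩ h
    exact harc i j h _ ((e i).symm x).2 _ ((e j).symm y).2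

/-! ### Vertices with large in- and out-degree -/

variable {V : Type*} [Fintype V] (G : Digraph V)

/-- The out-neighbours of a vertex. -/
noncomputable def outNbrs (v : V) : Finset V := univ.filter fun w => G.Adj v w

/-- The in-neighbours of a vertex. -/
noncomputable def inNbrs (v : V) : Finset V := univ.filter fun w => G.Adj w v

variable {G}

/-- Double count triples (b, A, C) with t-sets A in the in-neighbourhood and C in the
out-neighbourhood of b: a pair (A, C) with more than t such b would yield a copy. -/
theorem IsFreeOf.card_mul_choose_sq_le (hG : G.IsOriented) {t : ℕ} (ht : 1 ≤ t)
    (hfree : G.IsFreeOf ((dirPath 3).blowUp t)) (k : ℕ) :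
    (univ.filter fun v => k ≤ (G.inNbrs v).card ∧ k ≤ (G.outNbrs v).card).card
      * (k.choose t * k.choose t)
      ≤ (Fintype.card V).choose t * (Fintype.card V).choose t * t := by
  have key := card_mul_le_card_mul
    (s := univ.filter fun v => k ≤ (G.inNbrs v).card ∧ k ≤ (G.outNbrs v).card)
    (t := powersetCard t (univ : Finset V) ×ˢ powersetCard t (univ : Finset V))
    (m := k.choose t * k.choose t) (n := t)
    (fun b p => p.1 ⊆ G.inNbrs b ∧ p.2 ⊆ G.outNbrs b) ?_ ?_
  · simpa [card_product, card_powersetCard] using key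
  · intro b hb
    obtain ⟨h1, h2⟩ := (mem_filter.mp hb).2
    calc k.choose t * k.choose t
        ≤ (G.inNbrs b).card.choose t * (G.outNbrs b).card.choose t :=
          Nat.mul_le_mul (Nat.choose_le_choose t h1) (Nat.choose_le_choose t h2)
      _ = (powersetCard t (G.inNbrs b) ×ˢ powersetCard t (G.outNbrs b)).card := by
          simp [card_product, card_powersetCard]
      _ ≤ _ := by
          refine card_le_card fun p hp => ?_
          simp only [mem_product, mem_powersetCard] at hp
          simp [bipartiteAbove, mem_powersetCard, hp.1.1, hp.1.2, hp.2.1, hp.2.2]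
  · rintro ⟨A, C⟩ hp
    simp only [mem_product, mem_powersetCard] at hp
    by_contra! hlt
    refine hfree (hG.containsCopy_blowUp_dirPath ht hp.1.2 hlt.le hp.2.2 ?_ ?_)
    · intro a ha b hb
      have := ((mem_filter.mp hb).2.1) ha
      simpa [inNbrs] using this
    · intro b hb c hc
      have := ((mem_filter.mp hb).2.2) hc
      simpa [outNbrs] using this

theorem IsFreeOf.card_mul_pow_le (hG : G.IsOriented) {t : ℕ} (ht : 1 ≤ t)
    (hfree : G.IsFreeOf ((dirPath 3).blowUp t)) (k : ℕ) :
    ((univ.filter fun v => k ≤ (G.inNbrs v).card ∧ k ≤ (G.outNbrs v).card).card : ℝ)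
      * ((k + 1 - t : ℕ) : ℝ) ^ (2 * t) ≤ t * (Fintype.card V : ℝ) ^ (2 * t) := by
  have h := hfree.card_mul_choose_sq_le hG ht k
  set s := (univ.filter fun v => k ≤ (G.inNbrs v).card ∧ k ≤ (G.outNbrs v).card).card
  set n := Fintype.card V
  have h1 : (k + 1 - t) ^ t ≤ t.factorial * k.choose t := by
    rw [← Nat.descFactorial_eq_factorial_mul_choose]
    exact Nat.pow_sub_le_descFactorial k t
  have h2 : t.factorial * n.choose t ≤ n ^ t := by
    rw [← Nat.descFactorial_eq_factorial_mul_choose]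
    exact Nat.descFactorial_le_pow n t
  have h3 : s * (k + 1 - t) ^ (2 * t) ≤ t * n ^ (2 * t) := by
    calc s * (k + 1 - t) ^ (2 * t) = s * ((k + 1 - t) ^ t * (k + 1 - t) ^ t) := by ring
      _ ≤ s * ((t.factorial * k.choose t) * (t.factorial * k.choose t)) := by gcongr
      _ = t.factorial ^ 2 * (s * (k.choose t * k.choose t)) := by ring
      _ ≤ t.factorial ^ 2 * (n.choose t * n.choose t * t) := by gcongr
      _ = t * ((t.factorial * n.choose t) * (t.factorial * n.choose t)) := by ring
      _ ≤ t * (n ^ t * n ^ t) := by gcongr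
      _ = t * n ^ (2 * t) := by ring
  exact_mod_cast h3

/-- In a large oriented graph without a blown-up path, almost every vertex is nearly a source or
nearly a sink. -/
theorem exists_sum_min_card_nbrs_le {t : ℕ} (ht : 1 ≤ t) {η : ℝ} (hη : 0 < η) :
    ∃ N : ℕ, ∀ (V : Type*) [Fintype V] (G : Digraph V), N ≤ Fintype.card V → G.IsOriented →
      G.IsFreeOf ((dirPath 3).blowUp t) →
      ∑ v, (min (G.inNbrs v).card (G.outNbrs v).card : ℝ) ≤ η * (Fintype.card V : ℝ) ^ 2 := by
  -- The first bound gives k + 1 - t ≥ ηn/4 for k = ⌈ηn/2⌉; the second gives t(4/η)^(2t) ≤ ηn/2,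
  -- with the 1 ensuring n > 0.
  obtain ⟨N, hN⟩ := exists_nat_ge (max (4 * t / η) (2 * t * (4 / η) ^ (2 * t) / η + 1))
  refine ⟨N, fun V _ G hn hG hfree => ?_⟩
  set n := Fintype.card V with hndef
  have hNn : (N : ℝ) ≤ n := by exact_mod_cast hn
  have hn1 : 4 * t / η ≤ (n : ℝ) := (le_max_left _ _).trans (hN.trans hNn)
  have hn2 : 2 * t * (4 / η) ^ (2 * t) / η + 1 ≤ (n : ℝ) :=
    (le_max_right _ _).trans (hN.trans hNn)
  have hn0 : (0 : ℝ) < n := by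
    have : 0 ≤ 2 * t * (4 / η) ^ (2 * t) / η := by positivity
    linarith
  set k := ⌈η / 2 * n⌉₊ with hk
  have hkle : η / 2 * n ≤ k := Nat.le_ceil _
  have hklt : ∀ m : ℕ, m < k → (m : ℝ) < η / 2 * n := fun m hm => Nat.lt_ceil.mp hm
  have hk1 : η / 4 * n ≤ ((k + 1 - t : ℕ) : ℝ) := by
    have h1 : (k : ℝ) + 1 - t ≤ ((k + 1 - t : ℕ) : ℝ) := by
      have : k + 1 ≤ (k + 1 - t) + t := by omega
      have : ((k + 1 : ℕ) : ℝ) ≤ ((k + 1 - t : ℕ) : ℝ) + t := by exact_mod_cast this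
      push_cast at this
      linarith
    have h2 : 4 * t ≤ n * η := (div_le_iff₀ hη).mp hn1
    linarith
  set S := univ.filter fun v => k ≤ (G.inNbrs v).card ∧ k ≤ (G.outNbrs v).card with hS
  have hcount := hfree.card_mul_pow_le hG ht k
  rw [← hS, ← hndef] at hcount
  have hScard : (S.card : ℝ) ≤ η / 2 * n := by
    have h1 : (S.card : ℝ) * (η / 4 * n) ^ (2 * t) ≤ t * (n : ℝ) ^ (2 * t) :=
      le_trans (by gcongr) hcount
    have h2 : (S.card : ℝ) * (η / 4) ^ (2 * t) ≤ t := by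
      rw [mul_pow, ← mul_assoc] at h1
      exact le_of_mul_le_mul_right h1 (by positivity)
    have h3 : (S.card : ℝ) ≤ t * (4 / η) ^ (2 * t) := by
      have h4 : (η / 4) ^ (2 * t) * (4 / η) ^ (2 * t) = 1 := by
        rw [← mul_pow]; field_simp; simp
      calc (S.card : ℝ) = S.card * (η / 4) ^ (2 * t) * (4 / η) ^ (2 * t) := by
            rw [mul_assoc, h4, mul_one]
        _ ≤ t * (4 / η) ^ (2 * t) := by gcongr
    have h5 : 2 * t * (4 / η) ^ (2 * t) / η ≤ (n : ℝ) := by linarith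
    rw [div_le_iff₀ hη] at h5
    linarith
  have hpt : ∀ v, (min (G.inNbrs v).card (G.outNbrs v).card : ℝ)
      ≤ (if v ∈ S then (n : ℝ) else 0) + η / 2 * n := by
    intro v
    split_ifs with hv
    · have : (G.inNbrs v).card ≤ n := card_le_univ _
      have : ((G.inNbrs v).card : ℝ) ≤ n := by exact_mod_cast this
      have h0 : 0 ≤ η / 2 * n := by positivity
      exact (min_le_left _ _).trans (by linarith)
    · rw [zero_add]
      have hv' : (G.inNbrs v).card < k ∨ (G.outNbrs v).card < k := by
        by_contra! h
        exact hv (by simp [hS, h.1, h.2])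
      rcases hv' with h | h
      · exact (min_le_left _ _).trans (hklt _ h).le
      · exact (min_le_right _ _).trans (hklt _ h).le
  calc ∑ v, (min (G.inNbrs v).card (G.outNbrs v).card : ℝ)
      ≤ ∑ v, ((if v ∈ S then (n : ℝ) else 0) + η / 2 * n) := sum_le_sum fun v _ => hpt v
    _ = S.card * n + n * (η / 2 * n) := by
        rw [sum_add_distrib]
        simp [hndef]
    _ ≤ η / 2 * n * n + n * (η / 2 * n) := by gcongr
    _ = η * n ^ 2 := by ring

/-- Arcs that do not go from the vertices of larger out-degree to those of larger in-degree. -/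
theorem ncard_arcs_diff_le (G : Digraph V) :
    (((G.arcs \ (antidirectedBipartite
      (univ.filter fun v => (G.inNbrs v).card ≤ (G.outNbrs v).card)).arcs).ncard : ℕ) : ℝ)
      ≤ ∑ v, (min (G.inNbrs v).card (G.outNbrs v).card : ℝ) := by
  set U := univ.filter fun v => (G.inNbrs v).card ≤ (G.outNbrs v).card with hU
  -- `f v` is the smaller of the two arc sets at `v`. A bad arc has its head in `U` or its tail
  -- outside `U`, and is charged to that endpoint.
  let f : V → Finset (V × V) := fun v =>
    if v ∈ U then (G.inNbrs v).image fun u => (u, v) else (G.outNbrs v).image fun w => (v, w)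
  have hsub : G.arcs \ (antidirectedBipartite U).arcs ⊆ ((univ.biUnion f : Finset (V × V)) :
      Set (V × V)) := by
    rintro ⟨u, w⟩ ⟨h1, h2⟩
    have h1' : G.Adj u w := h1
    have h2' : ¬ (u ∈ U ∧ w ∉ U) := h2
    simp only [coe_biUnion, Set.mem_iUnion, mem_coe]
    by_cases hu : u ∈ U
    · have hw : w ∈ U := by tauto
      exact ⟨w, by simp, by simp [f, hw, inNbrs, h1']⟩
    · exact ⟨u, by simp, by simp [f, hu, outNbrs, h1']⟩
  have hf : ∀ v, (f v).card ≤ min (G.inNbrs v).card (G.outNbrs v).card := by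
    intro v
    by_cases hv : v ∈ U
    · have : (G.inNbrs v).card ≤ (G.outNbrs v).card := by simpa [hU] using hv
      simp only [f, hv, if_true, min_eq_left this]
      exact card_image_le
    · have : (G.outNbrs v).card < (G.inNbrs v).card := by simpa [hU] using hv
      simp only [f, hv, if_false, min_eq_right this.le]
      exact card_image_le
  have : (G.arcs \ (antidirectedBipartite U).arcs).ncard
      ≤ ∑ v, min (G.inNbrs v).card (G.outNbrs v).card := by
    calc _ ≤ ((univ.biUnion f : Finset (V × V)) : Set (V × V)).ncard :=
          Set.ncard_le_ncard hsub (finite_toSet _)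
      _ = (univ.biUnion f).card := Set.ncard_coe_finset _
      _ ≤ ∑ v, (f v).card := card_biUnion_le
      _ ≤ _ := sum_le_sum fun v _ => hf v
  exact_mod_cast this

/-! ### Comparing antidirected bipartite graphs -/

theorem ncard_arcs_antidirectedBipartite (U : Finset V) :
    (antidirectedBipartite U).arcs.ncard = U.card * Uᶜ.card := by
  have : (antidirectedBipartite U).arcs = ((U ×ˢ Uᶜ : Finset (V × V)) : Set (V × V)) := by
    ext ⟨u, v⟩
    simp [arcs, antidirectedBipartite]
  rw [this, Set.ncard_coe_finset, card_product]

/-- A lost arc has its tail in U \ W or its head in W \ U. -/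
theorem ncard_arcs_antidirectedBipartite_diff_le (U W : Finset V) :
    ((antidirectedBipartite U).arcs \ (antidirectedBipartite W).arcs).ncard
      ≤ (symmDiff U W).card * Fintype.card V := by
  have hsub : (antidirectedBipartite U).arcs \ (antidirectedBipartite W).arcs
      ⊆ ((((U \ W) ×ˢ univ) ∪ (univ ×ˢ (W \ U)) : Finset (V × V)) : Set (V × V)) := by
    rintro ⟨u, v⟩ ⟨h1, h2⟩
    have h1' : u ∈ U ∧ v ∉ U := h1
    have h2' : ¬ (u ∈ W ∧ v ∉ W) := h2
    simp only [coe_union, coe_product, Set.mem_union, Set.mem_prod, mem_coe, mem_sdiff, mem_univ]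
    tauto
  have hcard : (symmDiff U W).card = (U \ W).card + (W \ U).card :=
    card_union_of_disjoint disjoint_sdiff_sdiff
  calc _ ≤ _ := Set.ncard_le_ncard hsub (finite_toSet _)
    _ ≤ _ := by
      rw [Set.ncard_coe_finset]
      refine (card_union_le _ _).trans (le_of_eq ?_)
      rw [card_product, card_product, hcard, card_univ]
      ring

theorem editCost_triangle (G H K : Digraph V) :
    G.editCost K ≤ G.editCost H + H.editCost K := by
  have key : ∀ A B C : Set (V × V), (A \ C).ncard ≤ (A \ B).ncard + (B \ C).ncard := by
    intro A B C
    refine (Set.ncard_le_ncard (t := (A \ B) ∪ (B \ C)) ?_ (Set.toFinite _)).trans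
      (Set.ncard_union_le _ _)
    intro x
    simp only [Set.mem_sdiff, Set.mem_union]
    tauto
  have h1 := key G.arcs H.arcs K.arcs
  have h2 := key K.arcs H.arcs G.arcs
  unfold editCost
  omega

theorem editCost_antidirectedBipartite_le (U W : Finset V) :
    (antidirectedBipartite U).editCost (antidirectedBipartite W)
      ≤ 2 * ((symmDiff U W).card * Fintype.card V) := by
  have h1 := ncard_arcs_antidirectedBipartite_diff_le U W
  have h2 := ncard_arcs_antidirectedBipartite_diff_le W U
  rw [symmDiff_comm] at h2
  unfold editCost
  omega

theorem exists_card_eq_card_symmDiff_eq (U : Finset V) {m : ℕ} (hm : m ≤ Fintype.card V) :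
    ∃ W : Finset V, W.card = m ∧ ((symmDiff U W).card : ℝ) = |(U.card : ℝ) - m| := by
  rcases le_total m U.card with h | h
  · obtain ⟨W, hWU, hW⟩ := exists_subset_card_eq h
    refine ⟨W, hW, ?_⟩
    have : (symmDiff U W).card = U.card - m := by
      rw [symmDiff_of_ge hWU, card_sdiff_of_subset hWU, hW]
    have h' : (m : ℝ) ≤ U.card := by exact_mod_cast h
    rw [this, Nat.cast_sub h, abs_of_nonneg (by linarith)]
  · obtain ⟨W, hUW, -, hW⟩ := exists_subsuperset_card_eq (subset_univ U) h (by simpa using hm)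
    refine ⟨W, hW, ?_⟩
    have : (symmDiff U W).card = m - U.card := by
      rw [symmDiff_of_le hUW, card_sdiff_of_subset hUW, hW]
    have h' : (U.card : ℝ) ≤ m := by exact_mod_cast h
    rw [this, Nat.cast_sub h, abs_of_nonpos (by linarith)]
    ring

end Stability

end Digraph

/-! ### Stability -/

open Digraph in
theorem theorem3p1 (t : ℕ) (ht : 1 ≤ t) (ε : ℝ) (hε : 0 < ε) :
    ∃ δ : ℝ, 0 < δ ∧ ∃ N : ℕ, ∀ (V : Type*) [Fintype V] (G : Digraph V),
      N ≤ Fintype.card V →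
      G.IsOriented →
      G.IsFreeOf ((Digraph.dirPath 3).blowUp t) →
      (Fintype.card V : ℝ) ^ 2 / 4 - δ * (Fintype.card V : ℝ) ^ 2 ≤ (G.arcs.ncard : ℝ) →
      ∃ U : Finset V, U.card = Fintype.card V / 2 ∧
        (G.editCost (Digraph.antidirectedBipartite U) : ℝ) ≤ ε * (Fintype.card V : ℝ) ^ 2 := by
  classical
  -- With δ = η = β²/2, the deviation of |U₀| from n/2 is at most √(δ + η) n = βn.
  obtain ⟨β, hβ0, hβ1, hβε⟩ : ∃ β : ℝ, 0 < β ∧ β ≤ 1 ∧ 8 * β ≤ ε :=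
    ⟨min ε 1 / 8, by positivity, by linarith [min_le_right ε 1], by linarith [min_le_left ε 1]⟩
  have hη : 0 < β ^ 2 / 2 := by positivity
  obtain ⟨N₁, hN₁⟩ := exists_sum_min_card_nbrs_le ht hη
  obtain ⟨N₂, hN₂⟩ := exists_nat_ge (1 / β)
  refine ⟨β ^ 2 / 2, hη, max N₁ N₂, fun V _ G hn hG hfree harcs => ?_⟩
  have hmin := hN₁ V G ((le_max_left _ _).trans hn) hG hfree
  have hn₂ : (N₂ : ℝ) ≤ Fintype.card V := by exact_mod_cast (le_max_right _ _).trans hn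
  have hbad := G.ncard_arcs_diff_le.trans hmin
  set n := Fintype.card V with hndef
  set U₀ : Finset V := Finset.univ.filter fun v => (G.inNbrs v).card ≤ (G.outNbrs v).card
  have hβn : 1 ≤ β * n := by
    have := (div_le_iff₀ hβ0).mp (hN₂.trans hn₂)
    linarith
  have hparts := ncard_arcs_antidirectedBipartite U₀
  have hcompl : (U₀.card : ℝ) + (U₀ᶜ.card : ℝ) = n := by
    exact_mod_cast Finset.card_add_card_compl U₀
  have hG1 := Set.ncard_inter_add_ncard_sdiff_eq_ncard G.arcs (antidirectedBipartite U₀).arcs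
    (Set.toFinite _)
  have hG2 := Set.ncard_inter_add_ncard_sdiff_eq_ncard (antidirectedBipartite U₀).arcs G.arcs
    (Set.toFinite _)
  rw [Set.inter_comm, hparts] at hG2
  obtain ⟨W, hW, hsymm⟩ := exists_card_eq_card_symmDiff_eq U₀ (Nat.div_le_self n 2)
  refine ⟨W, hW, ?_⟩
  have hcost : (G.editCost (antidirectedBipartite W) : ℝ)
      ≤ G.editCost (antidirectedBipartite U₀)
        + 2 * (((symmDiff U₀ W).card : ℝ) * n) := by
    exact_mod_cast (editCost_triangle G (antidirectedBipartite U₀) _).trans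
      (Nat.add_le_add_left (editCost_antidirectedBipartite_le U₀ W) _)
  rw [hsymm] at hcost
  have hedit : (G.editCost (antidirectedBipartite U₀) : ℝ)
      = (G.arcs \ (antidirectedBipartite U₀).arcs).ncard
        + ((antidirectedBipartite U₀).arcs \ G.arcs).ncard := by
    simp [editCost]
  have hG1' : ((G.arcs ∩ (antidirectedBipartite U₀).arcs).ncard : ℝ)
      + (G.arcs \ (antidirectedBipartite U₀).arcs).ncard = G.arcs.ncard := by exact_mod_cast hG1
  have hG2' : ((G.arcs ∩ (antidirectedBipartite U₀).arcs).ncard : ℝ)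
      + ((antidirectedBipartite U₀).arcs \ G.arcs).ncard = U₀.card * U₀ᶜ.card := by
    exact_mod_cast hG2
  have hc : (U₀ᶜ.card : ℝ) = n - U₀.card := by linarith
  rw [hc] at hG2'
  generalize (U₀.card : ℝ) = x at *
  have hprod : x * (n - x) = (n : ℝ) ^ 2 / 4 - (x - n / 2) ^ 2 := by ring
  have hmissing : (0 : ℝ) ≤ ((antidirectedBipartite U₀).arcs \ G.arcs).ncard := Nat.cast_nonneg _
  have hsq : (x - n / 2) ^ 2 ≤ (β * n) ^ 2 := by rw [mul_pow]; linarith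
  have hx : |x - n / 2| ≤ β * n := abs_le_of_sq_le_sq hsq (by linarith)
  -- One βn is the deviation from n/2, the other absorbs the rounding of n/2.
  have hhalf : |x - ((n / 2 : ℕ) : ℝ)| ≤ 2 * (β * n) := by
    have h1 : ((n / 2 : ℕ) : ℝ) ≤ n / 2 := Nat.cast_div_le
    have h2 : (n : ℝ) ≤ 2 * ((n / 2 : ℕ) : ℝ) + 1 := by
      have : n ≤ 2 * (n / 2) + 1 := by omega
      exact_mod_cast this
    rw [abs_le] at hx ⊢
    constructor <;> linarith [hx.1, hx.2]
  have hββ : β ^ 2 * (n : ℝ) ^ 2 ≤ β * (n : ℝ) ^ 2 := by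
    have : β ^ 2 ≤ β := by nlinarith
    gcongr
  have hmove : |x - ((n / 2 : ℕ) : ℝ)| * n ≤ 2 * (β * n) * n := by gcongr
  have hsqx := sq_nonneg (x - (n : ℝ) / 2)
  have hfin : 8 * β * (n : ℝ) ^ 2 ≤ ε * (n : ℝ) ^ 2 := by gcongr
  -- Editing to U₀ costs at most (δ + 2η)n² ≤ 3βn²/2 and rebalancing at most 4βn², in total below
  -- 8βn².
  nlinarith
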